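/- **Setting.** There are $n$ robots and a horizon $T\ge 0$. Robot $i$ has initial state $x_{i,0}$, dynamics $x_{i,t+1}=f_i(x_{i,t},u_{i,t})$, and a finite set $\mathcal M_i$ of candidate control sequences $\sigma=(u_{i,0},\dots,u_{i,T-1})$. Sequences of different robots count as different; $\mathcal M=\bigsqcup_i\mathcal M_i$ and $N=|\mathcal M|$. A target state $y_t\in\mathbb R^{d_y}$ has a Gaussian prior with covariance $\Sigma_0\succeq0$ at $t=0$ and evolves as $y_{t+1}=A_ty_t+w_t$, $w_t\sim\mathcal N(0,W_t)$, $W_t\succeq0$. Robot $i$ measures $z_{i,t}=H_{i,t}(x_{i,t})y_t+v_{i,t}$, $v_{i,t}\sim\mathcal N(0,V_{i,t}(x_{i,t}))$, $V_{i,t}\succ0$, with independent noises. Assume that $y_1,\dots,y_T$ have positive definite covariances (so that the formulas below make sense). A set $S\subseteq\mathcal M$ is admissible, $S\in\mathcal I$, if $|S\cap\mathcal M_i|\le1$ for all $i$. Put $\Sigma_{S,0}=\Sigma_0$ and $$P_{S,t+1}=A_t\Sigma_{S,t}A_t^\top+W_t,\qquad \Sigma_{S,t+1}=\Big(P_{S,t+1}^{-1}+\sum_{\sigma\in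 S}H_{i,t+1}(x_{i,t+1})^\top V_{i,t+1}(x_{i,t+1})^{-1}H_{i,t+1}(x_{i,t+1})\Big)^{-1},$$ where in the sum $i$ is the robot of $\sigma$ and $x_{i,t}$ its states under $\sigma$. Let $$J(S)=\frac12\sum_{t=1}^T\big[\log\det P_{S,t}-\log\det\Sigma_{S,t}\big]-\sum_{\sigma\in S}r_iC_i(\sigma),\qquad g(S)=J(S)+\sum_{i=1}^n r_ic^{\max},$$ where $r_i\ge0$, $c^{\max}\ge 0$ and $0\le C_i(\sigma)\le c^{\max}$ for $\sigma\in\mathcal M_i$ (the first term of $J$ is the mutual information between $y_{1:T}$ and the measurements). Fix $\alpha>0$. **Centralized local search (CLS).** In round $1$ the ground set is $\mathcal M$. Start with $S_1=\{a\}$, $a$ maximizing $g(\{a\})$ over the ground set ($S_1=\emptyset$ if there is none). Repeatedly replace $S_1$ by some $S'\in\mathcal I$ with $g(S')\ge(1+\alpha/N^4)g(S_1)$ obtained by deleting an element of $S_1$, adding an element of the ground set outside $S_1$, or doing both (swap). Stop when no such replacement exists. Round $2$ does the same for $S_2$ with ground set $\mathcal M\setminus S_1$ and the same $N$. Return the better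 of $S_1,S_2$ with respect to $g$. All choices, including ties, are arbitrary. **Distributed local search (DLS).** This is the same scheme (with $N$ the size of the current ground set in each round), except that the updates are proposals $(d,a)$ of single robots, where $d\in S_k$ or $d=\mathrm{NOP}$ (no operation). With $S^-=S_k\setminus\{d\}$, $\Delta=(1+\alpha/N^4)g(S_k)-g(S^-)$ and $g(a|S)=g(S\cup\{a\})-g(S)$, a robot proposes $(d,\mathrm{NOP})$ if $\Delta\le0$. If it has no trajectory in $S^-$, it also goes through its own trajectories of the current ground set in descending order of $g(a|\emptyset)$, breaks off at the first with $g(a|\emptyset)<\Delta$, and proposes $(d,a)$ for those before with $g(a|S^-)\ge\Delta$. Any proposal other than $(\mathrm{NOP},\mathrm{NOP})$ may be the one carried out; a round stops when there are none. If $g(S_k)=0$, a round of either algorithm may also stop when no available update increases $g$ (otherwise it could go on forever with updates that keep the value $0$). **Claim.** $g\ge0$ on $\mathcal I$. Both CLS and DLS have executions that return a set. If $S^*$ maximizes $g$ over $\mathcal I$ and $S^{\mathrm{ls}}$ is any set that CLS or DLS can return, then $S^{\mathrm{ls}}\in\mathcal I$ and $$0\le g(S^*)\le4(1+\alpha)\,g(S^{\mathrm{ls}}).$$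 -/

import Mathlib

open scoped Matrix

/-- A robot control trajectory: a robot index `i` together with a control sequence
`u_{i,0}, …, u_{i,T-1}`. -/
abbrev Trajectory {n : ℕ} (T : ℕ) (U : Fin n → Type*) : Type _ := (i : Fin n) × (Fin T → U i)

/-- The data of the energy-aware active information acquisition problem: `n` robots, horizon `T`,
target state in `ℝ^dy`, robot state spaces `X i`, robot control sets `U i`. -/
structure AcquisitionProblem (n T dy : ℕ) (X U : Fin n → Type*) where
  /-- robot dynamics `x_{i,t+1} = f i x_{i,t} u_{i,t}` -/
  f : (i : Fin n) → X i → U i → X i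
  /-- initial robot states -/
  x0 : (i : Fin n) → X i
  /-- target motion matrices `A_t` -/
  A : ℕ → Matrix (Fin dy) (Fin dy) ℝ
  /-- target noise covariances `W_t` -/
  W : ℕ → Matrix (Fin dy) (Fin dy) ℝ
  /-- covariance of the Gaussian prior of the target state `y_0` -/
  Sigma0 : Matrix (Fin dy) (Fin dy) ℝ
  /-- dimension of the measurements of robot `i` -/
  dz : Fin n → ℕ
  /-- observation matrices `H_{i,t}(x)` -/
  H : (i : Fin n) → ℕ → X i → Matrix (Fin (dz i)) (Fin dy) ℝ
  /-- observation noise covariances `V_{i,t}(x)` -/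
  V : (i : Fin n) → ℕ → X i → Matrix (Fin (dz i)) (Fin (dz i)) ℝ
  /-- the candidate control trajectories of robot `i` -/
  M : (i : Fin n) → Finset (Fin T → U i)
  /-- energy cost of the control trajectories of robot `i` -/
  cost : (i : Fin n) → (Fin T → U i) → ℝ
  /-- weight of the energy cost of robot `i` -/
  r : Fin n → ℝ
  /-- upper bound of the energy costs -/
  cmax : ℝ
  W_posSemidef : ∀ t, (W t).PosSemidef
  Sigma0_posSemidef : Sigma0.PosSemidef
  V_posDef : ∀ i t x, (V i t x).PosDef
  r_nonneg : ∀ i, 0 ≤ r i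
  cmax_nonneg : 0 ≤ cmax
  cost_nonneg : ∀ i, ∀ σ ∈ M i, 0 ≤ cost i σ
  cost_le : ∀ i, ∀ σ ∈ M i, cost i σ ≤ cmax

namespace AcquisitionProblem

variable {n T dy : ℕ} {X U : Fin n → Type*}

/-- The covariance of the target state `y_t` before any measurement is taken. -/
def priorCov (P : AcquisitionProblem n T dy X U) : ℕ → Matrix (Fin dy) (Fin dy) ℝ
  | 0 => P.Sigma0
  | t + 1 => P.A t * P.priorCov t * (P.A t)ᵀ + P.W t

/-- The target states `y_1, …, y_T` have nondegenerate Gaussian laws. Equivalently, all predicted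
covariances of the Kalman filter below are invertible, for any set of trajectories, so that
the inverses and log-determinants in it are meaningful. -/
def Nondegenerate (P : AcquisitionProblem n T dy X U) : Prop :=
  ∀ t, 1 ≤ t → t ≤ T → (P.priorCov t).PosDef

/-- The state `x_{i,t}` of robot `i` when it applies the control sequence `u`
(constant after the horizon). -/
def state (P : AcquisitionProblem n T dy X U) (i : Fin n) (u : Fin T → U i) : ℕ → X i
  | 0 => P.x0 i
  | t + 1 => if h : t < T then P.f i (P.state i u t) (u ⟨t, h⟩) else P.state i u t

/-- The information matrix `H_{i,t}(x)ᵀ V_{i,t}(x)⁻¹ H_{i,t}(x)` of a measurement. -/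
noncomputable def info (P : AcquisitionProblem n T dy X U) (i : Fin n) (t : ℕ) (x : X i) :
    Matrix (Fin dy) (Fin dy) ℝ :=
  (P.H i t x)ᵀ * (P.V i t x)⁻¹ * P.H i t x

/-- Kalman filter prediction. -/
def predict (P : AcquisitionProblem n T dy X U) (t : ℕ) (Sg : Matrix (Fin dy) (Fin dy) ℝ) :
    Matrix (Fin dy) (Fin dy) ℝ :=
  P.A t * Sg * (P.A t)ᵀ + P.W t

/-- Kalman filter measurement update. For an admissible set `S`, summing over the trajectories
in `S` is summing over the robots that `S` assigns a trajectory. -/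
noncomputable def update (P : AcquisitionProblem n T dy X U) (S : Finset (Trajectory T U)) (t : ℕ)
    (Sg : Matrix (Fin dy) (Fin dy) ℝ) : Matrix (Fin dy) (Fin dy) ℝ :=
  (Sg⁻¹ + ∑ σ ∈ S, P.info σ.1 t (P.state σ.1 σ.2 t))⁻¹

/-- The estimate covariance `Σ_{S,t}`. -/
noncomputable def cov (P : AcquisitionProblem n T dy X U) (S : Finset (Trajectory T U)) :
    ℕ → Matrix (Fin dy) (Fin dy) ℝ
  | 0 => P.Sigma0
  | t + 1 => P.update S (t + 1) (P.predict t (P.cov S t))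

/-- The mutual information between `y_{1:T}` and `z_{S,1:T}`, in log-determinant form; the
summand `t` below belongs to time `t + 1`. -/
noncomputable def mutualInfo (P : AcquisitionProblem n T dy X U) (S : Finset (Trajectory T U)) :
    ℝ :=
  1 / 2 * ∑ t ∈ Finset.range T,
    (Real.log (P.predict t (P.cov S t)).det - Real.log (P.cov S (t + 1)).det)

/-- The weighted energy cost `C(S)`. -/
def energy (P : AcquisitionProblem n T dy X U) (S : Finset (Trajectory T U)) : ℝ :=
  ∑ σ ∈ S, P.r σ.1 * P.cost σ.1 σ.2

/-- The objective `J(S)`. -/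
noncomputable def J (P : AcquisitionProblem n T dy X U) (S : Finset (Trajectory T U)) : ℝ :=
  P.mutualInfo S - P.energy S

/-- The objective with the offset `∑ i, r_i c^max`. -/
noncomputable def g (P : AcquisitionProblem n T dy X U) (S : Finset (Trajectory T U)) : ℝ :=
  P.J S + ∑ i, P.r i * P.cmax

/-- The ground set of all candidate trajectories. -/
def ground (P : AcquisitionProblem n T dy X U) : Finset (Trajectory T U) :=
  Finset.univ.sigma P.M

/-- The independent sets of the partition matroid: at most one trajectory per robot. -/
def Admissible (P : AcquisitionProblem n T dy X U) (S : Finset (Trajectory T U)) : Prop :=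
  S ⊆ P.ground ∧ ∀ i : Fin n, (S.filter fun σ => σ.1 = i).card ≤ 1

end AcquisitionProblem

namespace LocalSearch

variable {E : Type*} [DecidableEq E]

/-- Initialization of a round with ground set `M`: a best singleton (with any choice among ties),
or `∅` if `M` is empty. -/
def Init (g : Finset E → ℝ) (M S : Finset E) : Prop :=
  (M = ∅ ∧ S = ∅) ∨ ∃ a ∈ M, (∀ b ∈ M, g {b} ≤ g {a}) ∧ S = {a}

/-- One pass of the loop of centralized local search, with current ground set `M`: the set `S`
is replaced by the result `S'` of a delete, add or swap operation that is admissible and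
passes the test. -/
def CLSStep (Adm : Finset E → Prop) (g : Finset E → ℝ) (α : ℝ) (N : ℕ) (M S S' : Finset E) :
    Prop :=
  ((∃ d ∈ S, S' = S \ {d}) ∨
    (∃ a ∈ M \ S, S' = S ∪ {a}) ∨
    (∃ d ∈ S, ∃ a ∈ M \ S, S' = (S \ {d}) ∪ {a})) ∧
  Adm S' ∧ (1 + α / (N : ℝ) ^ 4) * g S ≤ g S'

/-- `S` is a result of one round of centralized local search, for some choice of the operations.
The round may end once no operation that passes the test increases `g`. If `g S > 0`, this
says that no operation passes the test; if `g S = 0`, the test is also passed by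
operations that leave the value at `0`, and the loop may, but need not, execute those. -/
def CLSRound (Adm : Finset E → Prop) (g : Finset E → ℝ) (α : ℝ) (N : ℕ) (M S : Finset E) :
    Prop :=
  ∃ S₀, Init g M S₀ ∧ Relation.ReflTransGen (CLSStep Adm g α N M) S₀ S ∧
    ∀ S', CLSStep Adm g α N M S S' → g S' ≤ g S

/-- `R` is a better one of `S₁`, `S₂`. -/
def Better (g : Finset E → ℝ) (S₁ S₂ R : Finset E) : Prop :=
  (R = S₁ ∨ R = S₂) ∧ g S₁ ≤ g R ∧ g S₂ ≤ g R

/-- Centralized local search with ground set `M` can return `R`. -/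
def CLSReturns (Adm : Finset E → Prop) (g : Finset E → ℝ) (α : ℝ) (M R : Finset E) : Prop :=
  ∃ S₁ S₂, CLSRound Adm g α M.card M S₁ ∧ CLSRound Adm g α M.card (M \ S₁) S₂ ∧
    Better g S₁ S₂ R

/-- The marginal gain `g(a|S)`. -/
def marginal (g : Finset E → ℝ) (a : E) (S : Finset E) : ℝ := g (S ∪ {a}) - g S

/-- The deficiency `Δ = (1 + α/N⁴) g(S) - g(S \ {d})`, with `d = none` for "no operation". -/
noncomputable def deficiency (g : Finset E → ℝ) (α : ℝ) (N : ℕ) (S : Finset E) (d : Option E) :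
    ℝ :=
  (1 + α / (N : ℝ) ^ 4) * g S - g (S \ d.toFinset)

/-- Robot `i`, with its trajectories listed in `L`, can broadcast the proposal `(d, a)`, to
delete `d` and add `a` (`none` stands for "no operation"). It proposes a pure
deletion if `Δ ≤ 0`. If it has no trajectory in `S \ {d}`, it also proposes additions: it goes
through `L` in order, breaks off at the first trajectory whose marginal gain at `∅`
is less than `Δ`, and proposes those before with marginal gain at `S \ {d}` at least `Δ`. -/
noncomputable def FindProposal {n : ℕ} (robot : E → Fin n) (g : Finset E → ℝ) (α : ℝ) (N : ℕ)
    (S : Finset E) (i : Fin n) (L : List E) (d a : Option E) : Prop :=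
  (d.toFinset ⊆ S) ∧
  ((deficiency g α N S d ≤ 0 ∧ a = none) ∨
    ((∀ b ∈ S \ d.toFinset, robot b ≠ i) ∧
      ∃ a' ∈ L.takeWhile (fun b => decide (deficiency g α N S d ≤ marginal g b ∅)),
        deficiency g α N S d ≤ marginal g a' (S \ d.toFinset) ∧ a = some a'))

/-- One update of the team solution in distributed local search: a proposal of some robot,
other than "no operation" twice, is carried out. -/
def DLSStep {n : ℕ} (robot : E → Fin n) (g : Finset E → ℝ) (α : ℝ) (N : ℕ)
    (L : Fin n → List E) (S S' : Finset E) : Prop :=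
  ∃ (i : Fin n) (d a : Option E), FindProposal robot g α N S i (L i) d a ∧
    (d, a) ≠ (none, none) ∧ S' = (S \ d.toFinset) ∪ a.toFinset

/-- `S` is a result of one round of distributed local search, where robot `i` has the
trajectories listed in `L i`, for some order in which proposals arrive. The end of the round is
treated as in `CLSRound`. -/
def DLSRound {n : ℕ} (robot : E → Fin n) (g : Finset E → ℝ) (α : ℝ) (L : Fin n → List E)
    (S : Finset E) : Prop :=
  ∃ S₀, Init g (Finset.univ.biUnion fun i => (L i).toFinset) S₀ ∧
    Relation.ReflTransGen (DLSStep robot g α (∑ i, (L i).length) L) S₀ S ∧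
    ∀ S', DLSStep robot g α (∑ i, (L i).length) L S S' → g S' ≤ g S

/-- `L i` lists the trajectories of robot `i` without repetition, in descending order of their
marginal gains at `∅`. -/
def SortedLists {n : ℕ} (robot : E → Fin n) (g : Finset E → ℝ) (M : Finset E)
    (L : Fin n → List E) : Prop :=
  ∀ i, (L i).Nodup ∧ (∀ a, a ∈ L i ↔ a ∈ M ∧ robot a = i) ∧
    (L i).Pairwise fun a b => marginal g b ∅ ≤ marginal g a ∅

/-- Distributed local search with ground set `M` can return `R`. -/
def DLSReturns {n : ℕ} (robot : E → Fin n) (g : Finset E → ℝ) (α : ℝ) (M R : Finset E) : Prop :=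
  ∃ L : Fin n → List E, SortedLists robot g M L ∧ ∃ S₁ S₂,
    DLSRound robot g α L S₁ ∧
    DLSRound robot g α (fun i => (L i).filter fun a => decide (a ∉ S₁)) S₂ ∧
    Better g S₁ S₂ R

end LocalSearch

/-!
The mutual information is a monotone submodular function of the set of trajectories, and a local
optimum of such a function minus a modular cost is a constant-factor approximation.

**Submodularity.** Write the target states as `y_t = B_t ξ` with `ξ` standard normal (`loading`).
Every measurement is then a linear measurement of the fixed vector `ξ`, so the precision matrix of
`ξ` given the measurements up to time `t` is `1 + ∑ B_sᵀ F_s B_s`, summed over `1 ≤ s ≤ t`, where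
`F_s` is the sum over `S` of the information matrices at time `s` (`precision`). The Kalman filter
computes `Σ_{S,t} = B_t Λ_t⁻¹ B_tᵀ` for this precision matrix `Λ_t` (`cov_eq_loading`), and `log
det P_{S,t+1} - log det Σ_{S,t+1} = log det Λ_{t+1} - log det Λ_t` telescopes. Hence twice the
mutual information is `log det (1 + ∑ σ ∈ S, G σ)` with positive semidefinite `G σ`
(`exists_mutualInfo_eq_log_det`). Working with `ξ` instead of `y_{1:T}` avoids the inverse of the
joint covariance of `y_{1:T}`, which may be singular. Log-submodularity of the determinant
(`Matrix.PosDef.det_add_add_mul_det_le`) is the matrix determinant lemma together with the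
antitonicity of the matrix inverse.

**Approximation.** Let `g = f - c + R` with `f` monotone submodular, `c` modular and `c ≤ R` on
admissible sets. If `S` is locally optimal and `C` is admissible, exchange in `S`, one robot at a
time, the trajectory of that robot for the one in `C`. Summing the resulting inequalities gives
`2 f(S) - c(S) + error ≥ f(S ∪ C) - c(C)`, and `c(S) ≤ R` turns this into
`g(C) ≤ (2 + α) g(S)` (`le_mul_of_forall_exchange_le`, `IsLocalOpt.le_mul`). This already holds for
the result of the first round, and `2 + α ≤ 4 (1 + α)`.

**Algorithms.** The end of a first round is locally optimal: directly for centralized search, and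
for distributed search because `g(a|S \ {d}) ≤ g(a|∅)` makes breaking off a sorted list harmless
(`DLSRound.isLocalOpt`). Executions that return a set exist, since a reachable set of maximal value
is a possible end of a round.
-/

/-! ### Determinants of positive definite matrices -/

namespace Matrix

variable {ι κ : Type*} [Fintype ι] [Fintype κ]

theorem PosSemidef.exists_eq_transpose_mul_self [DecidableEq ι] {G : Matrix ι ι ℝ}
    (hG : G.PosSemidef) :
    ∃ R : Matrix ι ι ℝ, G = Rᵀ * R := by
  open scoped MatrixOrder in
  obtain ⟨R, hR⟩ := CStarAlgebra.nonneg_iff_eq_star_mul_self.mp hG.nonneg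
  exact ⟨R, by rw [hR, star_eq_conjTranspose, conjTranspose_eq_transpose_of_trivial]⟩

theorem PosSemidef.mul_mul_transpose_same {G : Matrix ι ι ℝ} (hG : G.PosSemidef)
    (B : Matrix κ ι ℝ) : (B * G * Bᵀ).PosSemidef := by
  simpa [conjTranspose_eq_transpose_of_trivial] using hG.mul_mul_conjTranspose_same B

theorem PosSemidef.transpose_mul_mul_same {G : Matrix ι ι ℝ} (hG : G.PosSemidef)
    (B : Matrix ι κ ℝ) : (Bᵀ * G * B).PosSemidef := by
  simpa [conjTranspose_eq_transpose_of_trivial] using hG.conjTranspose_mul_mul_same B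

theorem PosDef.mul_mul_transpose_same [DecidableEq κ] {A : Matrix ι ι ℝ} (hA : A.PosDef)
    {B : Matrix κ ι ℝ} (hB : (B * Bᵀ).PosDef) : (B * A * Bᵀ).PosDef := by
  have hinj : Function.Injective B.vecMul := by
    intro x y hxy
    have h : x ᵥ* (B * Bᵀ) = y ᵥ* (B * Bᵀ) := by
      simp only [← vecMul_vecMul]
      exact congrArg (· ᵥ* Bᵀ) hxy
    exact vecMul_injective_of_isUnit hB.isUnit h
  simpa [conjTranspose_eq_transpose_of_trivial] using hA.mul_mul_conjTranspose_same hinj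

variable [DecidableEq ι]

theorem PosSemidef.one_le_det_one_add {G : Matrix ι ι ℝ} (hG : G.PosSemidef) :
    1 ≤ (1 + G).det := by
  have hdet : (1 + G).det = ∏ i, (1 + hG.1.eigenvalues i) := by
    have h := congrArg (fun M : Matrix ι ι ℝ => (1 + M).det) hG.1.spectral_theorem
    simp only [Unitary.conjStarAlgAut_apply] at h
    rw [h]
    set V := hG.1.eigenvectorUnitary
    have h1 : (1 : Matrix ι ι ℝ) = V * (1 : Matrix ι ι ℝ) * star (V : Matrix ι ι ℝ) := by simp
    nth_rewrite 1 [h1]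
    have hV : (V : Matrix ι ι ℝ) * star (V : Matrix ι ι ℝ) = 1 := Unitary.coe_mul_star_self V
    rw [← add_mul, ← mul_add, det_mul, det_mul, mul_right_comm, ← det_mul, hV,
      det_one, one_mul, ← diagonal_one, diagonal_add, det_diagonal]
    simp
  rw [hdet]
  have h := Finset.prod_le_prod (s := Finset.univ) (f := fun _ : ι => (1 : ℝ))
    (fun _ _ => zero_le_one) fun i _ => le_add_of_nonneg_right (hG.eigenvalues_nonneg i)
  simpa using h

theorem PosDef.isUnit_det {A : Matrix ι ι ℝ} (hA : A.PosDef) : IsUnit A.det :=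
  hA.det_pos.ne'.isUnit

theorem PosDef.det_le_det_add {A G : Matrix ι ι ℝ} (hA : A.PosDef) (hG : G.PosSemidef) :
    A.det ≤ (A + G).det := by
  obtain ⟨R, rfl⟩ := hG.exists_eq_transpose_mul_self
  rw [det_add_mul _ _ hA.isUnit_det]
  exact le_mul_of_one_le_right hA.det_pos.le
    (hA.inv.posSemidef.mul_mul_transpose_same R).one_le_det_one_add

/-- Matrix inversion is antitone: the difference equals
`(A + H)⁻¹ (H + H A⁻¹ H) (A + H)⁻¹`. -/
theorem PosDef.inv_sub_inv_add_posSemidef {A H : Matrix ι ι ℝ} (hA : A.PosDef)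
    (hH : H.PosSemidef) : (A⁻¹ - (A + H)⁻¹).PosSemidef := by
  have hAH := hA.add_posSemidef hH
  have hHt : Hᵀ = H := by simpa [conjTranspose_eq_transpose_of_trivial] using hH.1.eq
  have hIt : (A + H)⁻¹ᵀ = (A + H)⁻¹ := by
    simpa [conjTranspose_eq_transpose_of_trivial] using hAH.inv.1.eq
  have h1 : A * A⁻¹ = 1 := mul_nonsing_inv _ hA.isUnit_det
  have h2 : (A + H) * (A + H)⁻¹ = 1 := mul_nonsing_inv _ hAH.isUnit_det
  have h3 : (A + H)⁻¹ * (A + H) = 1 := nonsing_inv_mul _ hAH.isUnit_det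
  have h4 : A⁻¹ * A = 1 := nonsing_inv_mul _ hA.isUnit_det
  have key : A⁻¹ - (A + H)⁻¹ = (A + H)⁻¹ * (H + H * A⁻¹ * Hᵀ) * (A + H)⁻¹ᵀ := by
    rw [hHt, hIt]
    have e1 : A⁻¹ - (A + H)⁻¹ = A⁻¹ * H * (A + H)⁻¹ := by
      calc A⁻¹ - (A + H)⁻¹ = A⁻¹ * ((A + H) * (A + H)⁻¹) - A⁻¹ * A * (A + H)⁻¹ := by
            rw [h2, h4]; simp
        _ = A⁻¹ * H * (A + H)⁻¹ := by noncomm_ring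
    rw [e1]
    congr 1
    calc A⁻¹ * H = (A + H)⁻¹ * (A + H) * (A⁻¹ * H) := by rw [h3, one_mul]
      _ = (A + H)⁻¹ * ((A * A⁻¹) * H + H * A⁻¹ * H) := by noncomm_ring
      _ = _ := by rw [h1, one_mul]
  rw [key]
  exact (hH.add (hA.inv.posSemidef.mul_mul_transpose_same H)).mul_mul_transpose_same _

/-- The determinant is log-submodular along positive semidefinite increments: by the matrix
determinant lemma, `det (A + RᵀR) / det A = det (1 + R A⁻¹ Rᵀ)`, which decreases as `A` grows. -/
theorem PosDef.det_add_add_mul_det_le {A H G : Matrix ι ι ℝ} (hA : A.PosDef)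
    (hH : H.PosSemidef) (hG : G.PosSemidef) :
    (A + H + G).det * A.det ≤ (A + H).det * (A + G).det := by
  have hAH := hA.add_posSemidef hH
  obtain ⟨R, rfl⟩ := hG.exists_eq_transpose_mul_self
  rw [det_add_mul _ _ hA.isUnit_det, det_add_mul _ _ hAH.isUnit_det, mul_assoc, mul_comm _ A.det]
  refine mul_le_mul_of_nonneg_left (mul_le_mul_of_nonneg_left ?_ hA.det_pos.le) hAH.det_pos.le
  have h := (PosDef.one.add_posSemidef
    (hAH.inv.posSemidef.mul_mul_transpose_same R)).det_le_det_add
      ((hA.inv_sub_inv_add_posSemidef hH).mul_mul_transpose_same R)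
  rwa [mul_sub, sub_mul, add_assoc, add_sub_cancel] at h

section SumOfIncrements

variable {E : Type*} {G : E → Matrix ι ι ℝ}

omit [Fintype ι] in
theorem posDef_one_add_sum (hG : ∀ a, (G a).PosSemidef) (S : Finset E) :
    (1 + ∑ a ∈ S, G a).PosDef :=
  PosDef.one.add_posSemidef (posSemidef_sum S fun a _ => hG a)

theorem log_det_one_add_sum_mono (hG : ∀ a, (G a).PosSemidef) :
    Monotone fun S : Finset E => Real.log (1 + ∑ a ∈ S, G a).det := by
  intro S S' h
  refine Real.log_le_log (posDef_one_add_sum hG S).det_pos ?_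
  classical
  rw [← Finset.sum_sdiff h, add_comm (∑ a ∈ S' \ S, G a), ← add_assoc]
  exact (posDef_one_add_sum hG S).det_le_det_add (posSemidef_sum _ fun a _ => hG a)

theorem log_det_one_add_sum_submodular [DecidableEq E] (hG : ∀ a, (G a).PosSemidef)
    (S S' : Finset E) :
    Real.log (1 + ∑ a ∈ S ∪ S', G a).det + Real.log (1 + ∑ a ∈ S ∩ S', G a).det ≤
      Real.log (1 + ∑ a ∈ S, G a).det + Real.log (1 + ∑ a ∈ S', G a).det := by
  have pos := fun Q : Finset E => (posDef_one_add_sum hG Q).det_pos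
  rw [← Real.log_mul (pos _).ne' (pos _).ne', ← Real.log_mul (pos _).ne' (pos _).ne']
  refine Real.log_le_log (mul_pos (pos _) (pos _)) ?_
  have h := (posDef_one_add_sum hG (S ∩ S')).det_add_add_mul_det_le
    (posSemidef_sum (S \ S') fun a _ => hG a) (posSemidef_sum (S' \ S) fun a _ => hG a)
  have e1 : ∑ a ∈ S ∩ S', G a + ∑ a ∈ S \ S', G a = ∑ a ∈ S, G a := by
    rw [← Finset.sum_union (Finset.disjoint_sdiff_inter S S').symm, Finset.union_comm,
      Finset.sdiff_union_inter]
  have e2 : ∑ a ∈ S ∩ S', G a + ∑ a ∈ S' \ S, G a = ∑ a ∈ S', G a := by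
    rw [Finset.inter_comm, ← Finset.sum_union (Finset.disjoint_sdiff_inter S' S).symm,
      Finset.union_comm, Finset.sdiff_union_inter]
  have e3 : ∑ a ∈ S, G a + ∑ a ∈ S' \ S, G a = ∑ a ∈ S ∪ S', G a := by
    rw [← Finset.sum_union Finset.disjoint_sdiff, Finset.union_sdiff_self_eq_union]
  rwa [add_assoc 1, e1, add_assoc 1, e3, add_assoc 1, e2] at h

end SumOfIncrements

end Matrix

/-! ### The measurement update in information form -/

namespace Matrix

variable {ι κ : Type*} [Fintype ι] [DecidableEq ι] [Fintype κ] [DecidableEq κ]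

/-- The measurement update of `B L⁻¹ Bᵀ` in information form amounts to adding `Bᵀ F B` to `L`. -/
theorem inv_inv_add_eq_mul_inv_mul {L : Matrix ι ι ℝ} (hL : L.PosDef) {B : Matrix κ ι ℝ}
    (hB : (B * Bᵀ).PosDef) {F : Matrix κ κ ℝ} (hF : F.PosSemidef) :
    ((B * L⁻¹ * Bᵀ)⁻¹ + F)⁻¹ = B * (L + Bᵀ * F * B)⁻¹ * Bᵀ := by
  have hP : (B * L⁻¹ * Bᵀ).PosDef := hL.inv.mul_mul_transpose_same hB
  set P := B * L⁻¹ * Bᵀ with hPdef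
  have hL' := hL.add_posSemidef (hF.transpose_mul_mul_same B)
  set L' := L + Bᵀ * F * B with hL'def
  have h1 : L * L⁻¹ = 1 := mul_nonsing_inv _ hL.isUnit_det
  have h2 : L'⁻¹ * L' = 1 := nonsing_inv_mul _ hL'.isUnit_det
  have h3 : P * P⁻¹ = 1 := mul_nonsing_inv _ hP.isUnit_det
  -- push-through identity `L⁻¹ Bᵀ = L'⁻¹ Bᵀ (1 + F P)`
  have push : L' * (L⁻¹ * Bᵀ) = Bᵀ * (1 + F * P) := by
    rw [hL'def, hPdef, Matrix.add_mul, ← Matrix.mul_assoc, h1, Matrix.mul_add,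
      Matrix.one_mul, Matrix.mul_one]
    simp only [Matrix.mul_assoc]
  have push' : L⁻¹ * Bᵀ = L'⁻¹ * Bᵀ * (1 + F * P) := by
    rw [Matrix.mul_assoc, ← push, ← Matrix.mul_assoc, h2, Matrix.one_mul]
  refine inv_eq_left_inv ?_
  have e : P⁻¹ + F = (1 + F * P) * P⁻¹ := by
    rw [Matrix.add_mul, one_mul, Matrix.mul_assoc, h3, Matrix.mul_one]
  rw [e, Matrix.mul_assoc B, ← Matrix.mul_assoc, Matrix.mul_assoc B, ← push',
    ← Matrix.mul_assoc B, ← hPdef, h3]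

/-- The information gain of a measurement of `B ξ` equals the increase of the log-determinant of
the precision matrix of `ξ`. -/
theorem log_det_sub_log_det_inv_inv_add {L : Matrix ι ι ℝ} (hL : L.PosDef) {B : Matrix κ ι ℝ}
    (hB : (B * Bᵀ).PosDef) {F : Matrix κ κ ℝ} (hF : F.PosSemidef) :
    Real.log (B * L⁻¹ * Bᵀ).det - Real.log ((B * L⁻¹ * Bᵀ)⁻¹ + F)⁻¹.det =
      Real.log (L + Bᵀ * F * B).det - Real.log L.det := by
  have hP : (B * L⁻¹ * Bᵀ).PosDef := hL.inv.mul_mul_transpose_same hB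
  have hL' := hL.add_posSemidef (hF.transpose_mul_mul_same B)
  have hdet : (L + Bᵀ * F * B).det = L.det * (1 + F * (B * L⁻¹ * Bᵀ)).det := by
    rw [Matrix.mul_assoc, det_add_mul _ _ hL.isUnit_det]
    simp only [Matrix.mul_assoc]
  have hpos : 0 < (1 + F * (B * L⁻¹ * Bᵀ)).det :=
    (mul_pos_iff_of_pos_left hL.det_pos).mp (hdet ▸ hL'.det_pos)
  set P := B * L⁻¹ * Bᵀ
  have e : P⁻¹ + F = (1 + F * P) * P⁻¹ := by
    rw [Matrix.add_mul, one_mul, Matrix.mul_assoc, mul_nonsing_inv _ hP.isUnit_det, Matrix.mul_one]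
  rw [hdet, Real.log_mul hL.det_pos.ne' hpos.ne', e, det_nonsing_inv, det_mul, det_nonsing_inv,
    Ring.inverse_eq_inv', Real.log_inv,
    Real.log_mul hpos.ne' (inv_ne_zero hP.det_pos.ne'), Real.log_inv]
  ring

omit [DecidableEq κ] in
/-- Covariances are realized by loadings on disjoint blocks of independent standard normal
variables: block `s` carries a square root of `Q s`. -/
theorem exists_orthogonal_loadings {Q : ℕ → Matrix κ κ ℝ} (hQ : ∀ s, (Q s).PosSemidef) (T : ℕ) :
    ∃ C : ℕ → Matrix κ (Fin (T + 1) × κ) ℝ,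
      (∀ s ≤ T, C s * (C s)ᵀ = Q s) ∧ ∀ r s, r ≠ s → C r * (C s)ᵀ = 0 := by
  classical
  choose R hR using fun s => (hQ s).exists_eq_transpose_mul_self
  refine ⟨fun s => of fun i p => if (p.1 : ℕ) = s then R s p.2 i else 0, ?_, ?_⟩
  · intro s hs
    ext i j
    rw [mul_apply, Fintype.sum_prod_type, Finset.sum_eq_single (⟨s, by omega⟩ : Fin (T + 1))]
    · simp [hR s, mul_apply]
    · intro b _ hb
      have : (b : ℕ) ≠ s := fun h => hb (Fin.ext h)
      simp [this]
    · simp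
  · intro r s hrs
    ext i j
    rw [mul_apply, zero_apply]
    refine Finset.sum_eq_zero fun p _ => ?_
    by_cases h : (p.1 : ℕ) = r
    · have : (p.1 : ℕ) ≠ s := h ▸ hrs
      simp [this]
    · simp [h]

end Matrix

/-! ### The mutual information as a log-determinant -/

namespace AcquisitionProblem

open Matrix

variable {n T dy : ℕ} {X U : Fin n → Type*} (P : AcquisitionProblem n T dy X U)

theorem info_posSemidef (i : Fin n) (t : ℕ) (x : X i) : (P.info i t x).PosSemidef :=
  (P.V_posDef i t x).inv.posSemidef.transpose_mul_mul_same _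

/-- The covariance of the innovation entering the target state at time `t`: the prior
covariance at time `0`, the process noise afterwards. -/
def innovationCov : ℕ → Matrix (Fin dy) (Fin dy) ℝ
  | 0 => P.Sigma0
  | t + 1 => P.W t

theorem innovationCov_posSemidef (t : ℕ) : (P.innovationCov t).PosSemidef := by
  cases t with
  | zero => exact P.Sigma0_posSemidef
  | succ t => exact P.W_posSemidef t

variable {ι : Type*} [Fintype ι]

/-- The target state as a linear function `y_t = B_t ξ` of a standard normal vector `ξ`, when
the innovation entering at time `t` is `C t ξ`. -/
def loading (P : AcquisitionProblem n T dy X U) (C : ℕ → Matrix (Fin dy) ι ℝ) :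
    ℕ → Matrix (Fin dy) ι ℝ
  | 0 => C 0
  | t + 1 => P.A t * P.loading C t + C (t + 1)

variable {P} {C : ℕ → Matrix (Fin dy) ι ℝ}

theorem loading_mul_transpose_of_lt (hC : ∀ r s, r ≠ s → C r * (C s)ᵀ = 0) {r s : ℕ}
    (h : r < s) : P.loading C r * (C s)ᵀ = 0 := by
  induction r with
  | zero => exact hC 0 s h.ne
  | succ r ih =>
    rw [loading, Matrix.add_mul, Matrix.mul_assoc, ih (by omega), hC _ _ h.ne]
    simp

theorem loading_mul_transpose_self (hC : ∀ r s, r ≠ s → C r * (C s)ᵀ = 0)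
    (hC' : ∀ s ≤ T, C s * (C s)ᵀ = P.innovationCov s) {t : ℕ} (ht : t ≤ T) :
    P.loading C t * (P.loading C t)ᵀ = P.priorCov t := by
  induction t with
  | zero => exact hC' 0 ht
  | succ t ih =>
    have h0 : P.loading C t * (C (t + 1))ᵀ = 0 := loading_mul_transpose_of_lt hC t.lt_succ_self
    have h0' : C (t + 1) * (P.loading C t)ᵀ = 0 := by
      simpa [transpose_mul] using congrArg transpose h0
    rw [loading, priorCov, ← ih (by omega), transpose_add, transpose_mul, Matrix.add_mul,
      Matrix.mul_add, Matrix.mul_add, hC' _ ht, innovationCov, Matrix.mul_assoc _ _ (C (t + 1))ᵀ,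
      h0, ← Matrix.mul_assoc (C (t + 1)), h0']
    simp [Matrix.mul_assoc]

variable [DecidableEq ι]

variable (P C) in
/-- The precision matrix of the standard normal vector `ξ` given the measurements of the
trajectories in `S` at times `1, …, t`. -/
noncomputable def precision (S : Finset (Trajectory T U)) (t : ℕ) : Matrix ι ι ℝ :=
  1 + ∑ s ∈ Finset.range t, (P.loading C (s + 1))ᵀ *
    (∑ σ ∈ S, P.info σ.1 (s + 1) (P.state σ.1 σ.2 (s + 1))) * P.loading C (s + 1)

variable (S : Finset (Trajectory T U))

theorem precision_posDef (t : ℕ) : (P.precision C S t).PosDef :=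
  PosDef.one.add_posSemidef <| posSemidef_sum _ fun _ _ =>
    (posSemidef_sum _ fun _ _ => P.info_posSemidef _ _ _).transpose_mul_mul_same _

omit [Fintype ι] in
theorem precision_succ (t : ℕ) : P.precision C S (t + 1) = P.precision C S t +
    (P.loading C (t + 1))ᵀ * (∑ σ ∈ S, P.info σ.1 (t + 1) (P.state σ.1 σ.2 (t + 1))) *
      P.loading C (t + 1) := by
  rw [precision, Finset.sum_range_succ, ← add_assoc, precision]

/-- Past measurements carry no information on future innovations. -/
theorem inv_precision_mul_transpose_of_lt (hC : ∀ r s, r ≠ s → C r * (C s)ᵀ = 0) {t s : ℕ}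
    (h : t < s) : (P.precision C S t)⁻¹ * (C s)ᵀ = (C s)ᵀ := by
  have h1 : P.precision C S t * (C s)ᵀ = (C s)ᵀ := by
    rw [precision, Matrix.add_mul, Matrix.one_mul, Matrix.sum_mul, Finset.sum_eq_zero, add_zero]
    intro r hr
    have := Finset.mem_range.mp hr
    rw [Matrix.mul_assoc, loading_mul_transpose_of_lt hC (by omega), Matrix.mul_zero]
  conv_lhs => rw [← h1]
  rw [← Matrix.mul_assoc, nonsing_inv_mul _ (precision_posDef S t).isUnit_det, Matrix.one_mul]

/-- The cross terms between the state and its next innovation vanish, since the past measurements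
leave the innovation at its prior law. -/
theorem predict_loading (hC : ∀ r s, r ≠ s → C r * (C s)ᵀ = 0)
    (hC' : ∀ s ≤ T, C s * (C s)ᵀ = P.innovationCov s) {t : ℕ} (ht : t < T) :
    P.predict t (P.loading C t * (P.precision C S t)⁻¹ * (P.loading C t)ᵀ) =
      P.loading C (t + 1) * (P.precision C S t)⁻¹ * (P.loading C (t + 1))ᵀ := by
  have h0 : P.loading C t * (C (t + 1))ᵀ = 0 := loading_mul_transpose_of_lt hC t.lt_succ_self
  have h0' : C (t + 1) * (P.loading C t)ᵀ = 0 := by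
    simpa [transpose_mul] using congrArg transpose h0
  have hL := inv_precision_mul_transpose_of_lt (P := P) S hC t.lt_succ_self
  have hsymm : (P.precision C S t)⁻¹ᵀ = (P.precision C S t)⁻¹ := by
    simpa [conjTranspose_eq_transpose_of_trivial] using (precision_posDef S t).inv.1.eq
  have hL' : C (t + 1) * (P.precision C S t)⁻¹ = C (t + 1) := by
    simpa [transpose_mul, hsymm] using congrArg transpose hL
  have hW : C (t + 1) * (C (t + 1))ᵀ = P.W t := hC' _ ht
  rw [loading, predict, transpose_add, transpose_mul, Matrix.add_mul, Matrix.add_mul,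
    Matrix.mul_add, Matrix.mul_add, hL', hW, ← Matrix.mul_assoc (C (t + 1)), h0',
    Matrix.mul_assoc _ _ (C (t + 1))ᵀ, hL, Matrix.mul_assoc _ _ (C (t + 1))ᵀ, h0]
  simp [Matrix.mul_assoc]

theorem cov_eq_loading (hP : P.Nondegenerate) (hC : ∀ r s, r ≠ s → C r * (C s)ᵀ = 0)
    (hC' : ∀ s ≤ T, C s * (C s)ᵀ = P.innovationCov s) {t : ℕ} (ht : t ≤ T) :
    P.cov S t = P.loading C t * (P.precision C S t)⁻¹ * (P.loading C t)ᵀ := by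
  induction t with
  | zero => simpa [cov, precision, loading, innovationCov] using (hC' 0 ht).symm
  | succ t ih =>
    have hB := hP (t + 1) (by omega) ht
    rw [← loading_mul_transpose_self hC hC' ht] at hB
    rw [cov, ih (by omega), predict_loading S hC hC' ht, update,
      inv_inv_add_eq_mul_inv_mul (precision_posDef S t) hB
        (posSemidef_sum _ fun _ _ => P.info_posSemidef _ _ _), precision_succ]

theorem mutualInfo_eq_log_det_precision (hP : P.Nondegenerate)
    (hC : ∀ r s, r ≠ s → C r * (C s)ᵀ = 0)
    (hC' : ∀ s ≤ T, C s * (C s)ᵀ = P.innovationCov s) :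
    P.mutualInfo S = 1 / 2 * Real.log (P.precision C S T).det := by
  have hstep : ∀ t ∈ Finset.range T,
      Real.log (P.predict t (P.cov S t)).det - Real.log (P.cov S (t + 1)).det =
        Real.log (P.precision C S (t + 1)).det - Real.log (P.precision C S t).det := by
    intro t ht
    have ht := Finset.mem_range.mp ht
    have hB := hP (t + 1) (by omega) ht
    rw [← loading_mul_transpose_self hC hC' ht] at hB
    rw [cov, cov_eq_loading S hP hC hC' ht.le, predict_loading S hC hC' ht, update,
      log_det_sub_log_det_inv_inv_add (precision_posDef S t) hB
        (posSemidef_sum _ fun _ _ => P.info_posSemidef _ _ _), precision_succ]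
  rw [mutualInfo, Finset.sum_congr rfl hstep,
    Finset.sum_range_sub fun t => Real.log (P.precision C S t).det]
  simp [precision]

/-- All measurements being conditionally independent given a standard normal vector, the
mutual information is half the log-determinant of its precision matrix, in which each trajectory
contributes a fixed positive semidefinite summand. -/
theorem exists_mutualInfo_eq_log_det (hP : P.Nondegenerate) :
    ∃ G : Trajectory T U → Matrix (Fin (T + 1) × Fin dy) (Fin (T + 1) × Fin dy) ℝ,
      (∀ σ, (G σ).PosSemidef) ∧
        ∀ S, P.mutualInfo S = 1 / 2 * Real.log (1 + ∑ σ ∈ S, G σ).det := by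
  obtain ⟨C, hC', hC⟩ := exists_orthogonal_loadings P.innovationCov_posSemidef T
  refine ⟨fun σ => ∑ s ∈ Finset.range T, (P.loading C (s + 1))ᵀ *
    P.info σ.1 (s + 1) (P.state σ.1 σ.2 (s + 1)) * P.loading C (s + 1), fun σ => ?_, fun S => ?_⟩
  · exact posSemidef_sum _ fun _ _ => (P.info_posSemidef _ _ _).transpose_mul_mul_same _
  · rw [mutualInfo_eq_log_det_precision S hP hC hC', precision, Finset.sum_comm]
    simp only [Matrix.mul_sum, Matrix.sum_mul]

theorem mutualInfo_mono (hP : P.Nondegenerate) : Monotone P.mutualInfo := by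
  obtain ⟨G, hG, h⟩ := exists_mutualInfo_eq_log_det hP
  intro S S' hS
  rw [h, h]
  exact mul_le_mul_of_nonneg_left (log_det_one_add_sum_mono hG hS) (by norm_num)

theorem mutualInfo_submodular [DecidableEq (Trajectory T U)] (hP : P.Nondegenerate)
    (S S' : Finset (Trajectory T U)) :
    P.mutualInfo (S ∪ S') + P.mutualInfo (S ∩ S') ≤ P.mutualInfo S + P.mutualInfo S' := by
  obtain ⟨G, hG, h⟩ := exists_mutualInfo_eq_log_det hP
  simp only [h]
  linarith [log_det_one_add_sum_submodular hG S S']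

theorem mutualInfo_empty (hP : P.Nondegenerate) : P.mutualInfo ∅ = 0 := by
  obtain ⟨G, -, h⟩ := exists_mutualInfo_eq_log_det hP
  simp [h]

end AcquisitionProblem

namespace LocalSearch

variable {E : Type*} [DecidableEq E]

/-! ### Locally optimal sets of a submodular function minus a cost -/

section Exchange

variable {ι : Type*} [DecidableEq ι] {robot : E → ι} {f : Finset E → ℝ}

/-- Deleting the blocks one at a time from the full set loses at most what deleting all of them
does. -/
theorem sum_sub_sdiff_filter_le
    (hsub : ∀ A B, f (A ∪ B) + f (A ∩ B) ≤ f A + f B) (S : Finset E) (I : Finset ι) :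
    ∑ i ∈ I, (f S - f (S \ S.filter (robot · = i))) ≤ f S - f (S.filter (robot · ∉ I)) := by
  induction I using Finset.induction_on with
  | empty => simp
  | insert j I hj ih =>
    rw [Finset.sum_insert hj]
    have h := hsub (S \ S.filter (robot · = j)) (S.filter (robot · ∉ I))
    have e1 : S \ S.filter (robot · = j) ∪ S.filter (robot · ∉ I) = S := by
      ext a
      simp only [Finset.mem_union, Finset.mem_sdiff, Finset.mem_filter]
      grind
    have e2 : (S \ S.filter (robot · = j)) ∩ S.filter (robot · ∉ I) =
        S.filter (robot · ∉ insert j I) := by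
      ext a
      simp only [Finset.mem_inter, Finset.mem_sdiff, Finset.mem_filter, Finset.mem_insert]
      grind
    rw [e1, e2] at h
    linarith

theorem sub_le_sum_union_filter_sub (hmono : Monotone f)
    (hsub : ∀ A B, f (A ∪ B) + f (A ∩ B) ≤ f A + f B) (S C : Finset E) (I : Finset ι) :
    f (S ∪ C.filter (robot · ∈ I)) - f S ≤
      ∑ i ∈ I, (f (S ∪ C.filter (robot · = i)) - f S) := by
  induction I using Finset.induction_on with
  | empty => simp
  | insert j I hj ih =>
    rw [Finset.sum_insert hj]
    have h := hsub (S ∪ C.filter (robot · = j)) (S ∪ C.filter (robot · ∈ I))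
    have e1 : S ∪ C.filter (robot · = j) ∪ (S ∪ C.filter (robot · ∈ I)) =
        S ∪ C.filter (robot · ∈ insert j I) := by
      ext a
      simp only [Finset.mem_union, Finset.mem_filter, Finset.mem_insert]
      grind
    have h2 : f S ≤ f ((S ∪ C.filter (robot · = j)) ∩ (S ∪ C.filter (robot · ∈ I))) :=
      hmono (Finset.subset_inter Finset.subset_union_left Finset.subset_union_left)
    rw [e1] at h
    linarith

/-- If exchanging, for any one robot, the trajectory in `S` for the one in `C` gains at most the
factor `1 + ε`, then `g C` is at most about `2 g S`. The exchanges of all robots together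
lose at most `f S` by submodularity, and gain at least `f (S ∪ C) - f S`; the cost of `S` is
compensated by the offset `R`. -/
theorem le_mul_of_forall_exchange_le {g : Finset E → ℝ} {c : E → ℝ} {R ε : ℝ}
    (hg : ∀ S, g S = f S - ∑ a ∈ S, c a + R) (hmono : Monotone f)
    (hsub : ∀ A B, f (A ∪ B) + f (A ∩ B) ≤ f A + f B) (hf : 0 ≤ f ∅) {S C : Finset E}
    (hS : ∑ a ∈ S, c a ≤ R)
    (hloc : ∀ i, g (S \ S.filter (robot · = i) ∪ C.filter (robot · = i)) ≤ (1 + ε) * g S) :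
    g C ≤ (2 + ((S ∪ C).image robot).card * ε) * g S := by
  set I := (S ∪ C).image robot with hI
  have hSI : ∀ a ∈ S, robot a ∈ I := fun a ha =>
    Finset.mem_image_of_mem _ (Finset.mem_union_left _ ha)
  have hCI : ∀ a ∈ C, robot a ∈ I := fun a ha =>
    Finset.mem_image_of_mem _ (Finset.mem_union_right _ ha)
  have h1 := sum_sub_sdiff_filter_le (robot := robot) hsub S I
  have h2 := sub_le_sum_union_filter_sub (robot := robot) hmono hsub S C I
  rw [Finset.filter_eq_empty_iff.mpr fun a ha => not_not.mpr (hSI a ha)] at h1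
  rw [Finset.filter_true_of_mem hCI] at h2
  have hCf : f C ≤ f (S ∪ C) := hmono Finset.subset_union_right
  have hcS := Finset.sum_fiberwise_of_maps_to hSI c
  have hcC := Finset.sum_fiberwise_of_maps_to hCI c
  have hstep : ∀ i ∈ I, f (S ∪ C.filter (robot · = i)) - f S
      - (f S - f (S \ S.filter (robot · = i)))
      + ∑ a ∈ S.filter (robot · = i), c a - ∑ a ∈ C.filter (robot · = i), c a ≤ ε * g S := by
    intro i _
    set Si := S.filter (robot · = i)
    set Ci := C.filter (robot · = i)
    have hl := hloc i
    have hs := hsub S (S \ Si ∪ Ci)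
    have hm : f (S \ Si) ≤ f (S ∩ (S \ Si ∪ Ci)) :=
      hmono (Finset.subset_inter Finset.sdiff_subset Finset.subset_union_left)
    have e1 : S ∪ (S \ Si ∪ Ci) = S ∪ Ci := by
      rw [← Finset.union_assoc, Finset.union_eq_left.mpr Finset.sdiff_subset]
    have hdisj : Disjoint (S \ Si) Ci := by
      rw [Finset.disjoint_left]
      intro a ha ha'
      simp only [Si, Ci, Finset.mem_sdiff, Finset.mem_filter] at ha ha'
      exact ha.2 ⟨ha.1, ha'.2⟩
    have hcost : ∑ a ∈ S \ Si ∪ Ci, c a = ∑ a ∈ S, c a - ∑ a ∈ Si, c a + ∑ a ∈ Ci, c a := by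
      rw [Finset.sum_union hdisj, ← Finset.sum_sdiff (Finset.filter_subset (robot · = i) S)]
      ring
    rw [e1] at hs
    rw [hg (S \ Si ∪ Ci), hcost, add_mul, one_mul] at hl
    have hgS := hg S
    linarith
  have hsum := Finset.sum_le_sum hstep
  rw [Finset.sum_sub_distrib, Finset.sum_add_distrib, Finset.sum_sub_distrib, hcS, hcC,
    Finset.sum_const, nsmul_eq_mul] at hsum
  have hgS := hg S
  have hgC := hg C
  rw [add_mul, mul_assoc]
  linarith

end Exchange

/-! ### Sets with at most one trajectory per robot -/

/-- The independent sets of the partition matroid on `M` whose blocks are the fibres of `robot`. -/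
def OnePerRobot {n : ℕ} (robot : E → Fin n) (M S : Finset E) : Prop :=
  S ⊆ M ∧ ∀ i : Fin n, (S.filter fun a => robot a = i).card ≤ 1

omit [DecidableEq E] in
theorem exists_toFinset_eq_of_card_le_one {S : Finset E} (h : S.card ≤ 1) :
    ∃ d : Option E, d.toFinset = S := by
  obtain rfl | ⟨a, ha⟩ := S.eq_empty_or_nonempty
  · exact ⟨none, rfl⟩
  · refine ⟨some a, ?_⟩
    rw [Option.toFinset_some]
    exact Finset.Subset.antisymm (by simpa using ha)
      fun b hb => Finset.mem_singleton.mpr (Finset.card_le_one.mp h b hb a ha)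

variable {n : ℕ} {robot : E → Fin n} {M S C : Finset E}

omit [DecidableEq E] in
theorem onePerRobot_iff : OnePerRobot robot M S ↔
    S ⊆ M ∧ ∀ a ∈ S, ∀ b ∈ S, robot a = robot b → a = b := by
  simp only [OnePerRobot, Finset.card_le_one, Finset.mem_filter]
  exact and_congr_right fun _ => ⟨fun h a ha b hb hab => h _ a ⟨ha, hab⟩ b ⟨hb, rfl⟩,
    fun h i a ha b hb => h a ha.1 b hb.1 (ha.2.trans hb.2.symm)⟩

omit [DecidableEq E] in
theorem OnePerRobot.empty : OnePerRobot robot M ∅ := by simp [onePerRobot_iff]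

omit [DecidableEq E] in
theorem OnePerRobot.singleton {a : E} (ha : a ∈ M) : OnePerRobot robot M {a} := by
  simp [onePerRobot_iff, ha]

theorem OnePerRobot.exchange (hS : OnePerRobot robot M S) (hC : OnePerRobot robot M C)
    (i : Fin n) :
    OnePerRobot robot M (S \ S.filter (robot · = i) ∪ C.filter (robot · = i)) := by
  rw [onePerRobot_iff] at *
  refine ⟨Finset.union_subset (Finset.sdiff_subset.trans hS.1)
    ((Finset.filter_subset _ _).trans hC.1), ?_⟩
  intro a ha b hb hab
  simp only [Finset.mem_union, Finset.mem_sdiff, Finset.mem_filter] at ha hb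
  grind

/-- `S` cannot be improved by more than the factor `1 + ε` by deleting at most one and adding
at most one trajectory. -/
def IsLocalOpt (robot : E → Fin n) (g : Finset E → ℝ) (ε : ℝ) (M S : Finset E) : Prop :=
  ∀ d a : Option E, d.toFinset ⊆ S → a.toFinset ⊆ M →
    OnePerRobot robot M (S \ d.toFinset ∪ a.toFinset) →
      g (S \ d.toFinset ∪ a.toFinset) ≤ (1 + ε) * g S

theorem IsLocalOpt.exchange_le {g : Finset E → ℝ} {ε : ℝ} (h : IsLocalOpt robot g ε M S)
    (hS : OnePerRobot robot M S) (hC : OnePerRobot robot M C) (i : Fin n) :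
    g (S \ S.filter (robot · = i) ∪ C.filter (robot · = i)) ≤ (1 + ε) * g S := by
  obtain ⟨d, hd⟩ := exists_toFinset_eq_of_card_le_one (hS.2 i)
  obtain ⟨a, ha⟩ := exists_toFinset_eq_of_card_le_one (hC.2 i)
  have hex := hS.exchange hC i
  rw [← hd, ← ha] at hex ⊢
  exact h d a (hd ▸ Finset.filter_subset _ _)
    (ha ▸ (Finset.filter_subset _ _).trans hC.1) hex

theorem natCast_mul_div_pow_four_le {k N : ℕ} (hk : k ≤ N) {α : ℝ} (hα : 0 ≤ α) :
    (k : ℝ) * (α / (N : ℝ) ^ 4) ≤ α := by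
  -- for `N = 0` the quotient is the junk value `0`
  obtain rfl | hN := N.eq_zero_or_pos
  · simpa using hα
  have h : (k : ℝ) ≤ (N : ℝ) ^ 4 := by exact_mod_cast hk.trans (Nat.le_self_pow (by norm_num) N)
  rw [mul_div_assoc', div_le_iff₀ (by positivity), mul_comm]
  exact mul_le_mul_of_nonneg_left h hα

/-- A round with ground set `M` loses at most the factor `2 + α`: at most `N` robots take part
in the exchanges, each of which contributes an error `α / N⁴`. -/
theorem IsLocalOpt.le_mul {g f : Finset E → ℝ} {c : E → ℝ} {R α : ℝ} {N : ℕ} (hα : 0 ≤ α)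
    (hN : M.card ≤ N) (hg : ∀ S, g S = f S - ∑ a ∈ S, c a + R) (hmono : Monotone f)
    (hsub : ∀ A B, f (A ∪ B) + f (A ∩ B) ≤ f A + f B) (hf : 0 ≤ f ∅)
    (hR : ∀ S, OnePerRobot robot M S → ∑ a ∈ S, c a ≤ R)
    (h : IsLocalOpt robot g (α / (N : ℝ) ^ 4) M S)
    (hS : OnePerRobot robot M S) (hC : OnePerRobot robot M C) :
    g C ≤ (2 + α) * g S := by
  refine (le_mul_of_forall_exchange_le hg hmono hsub hf (hR S hS) (h.exchange_le hS hC)).trans ?_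
  have hgS : 0 ≤ g S := by
    rw [hg]
    linarith [hR S hS, hmono (Finset.empty_subset S)]
  refine mul_le_mul_of_nonneg_right ?_ hgS
  have hcard : ((S ∪ C).image robot).card ≤ N :=
    Finset.card_image_le.trans ((Finset.card_le_card (Finset.union_subset hS.1 hC.1)).trans hN)
  linarith [natCast_mul_div_pow_four_le hcard hα]

/-! ### Rounds of local search -/

omit [DecidableEq E] in
theorem exists_init (g : Finset E → ℝ) (M : Finset E) : ∃ S, Init g M S := by
  obtain rfl | hM := M.eq_empty_or_nonempty
  · exact ⟨∅, Or.inl ⟨rfl, rfl⟩⟩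
  · obtain ⟨a, ha, h⟩ := M.exists_max_image (fun a => g {a}) hM
    exact ⟨{a}, Or.inr ⟨a, ha, h, rfl⟩⟩

omit [DecidableEq E] in
theorem Init.onePerRobot {g : Finset E → ℝ} {M' : Finset E} (h : Init g M' S) (hM : M' ⊆ M) :
    OnePerRobot robot M S := by
  obtain ⟨-, rfl⟩ | ⟨a, ha, -, rfl⟩ := h
  · exact .empty
  · exact .singleton (hM ha)

omit [DecidableEq E] in
/-- A best one among the finitely many reachable sets is a possible end of a round. -/
theorem exists_reachable_maximal {r : Finset E → Finset E → Prop} (g : Finset E → ℝ)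
    {S₀ : Finset E} (hM : ∀ S, Relation.ReflTransGen r S₀ S → S ⊆ M) :
    ∃ S, Relation.ReflTransGen r S₀ S ∧ ∀ S', r S S' → g S' ≤ g S := by
  have hfin : {S | Relation.ReflTransGen r S₀ S}.Finite :=
    M.powerset.finite_toSet.subset fun S hS => by simpa using hM S hS
  obtain ⟨S, hS, hmax⟩ := Set.exists_max_image _ g hfin ⟨S₀, .refl⟩
  exact ⟨S, hS, fun S' h => hmax S' (hS.tail h)⟩

variable {g : Finset E → ℝ} {α : ℝ} {N : ℕ}

theorem reachable_onePerRobot_of_CLSStep {M' S₀ : Finset E} (h₀ : OnePerRobot robot M S₀)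
    (h : Relation.ReflTransGen (CLSStep (OnePerRobot robot M) g α N M') S₀ S) :
    OnePerRobot robot M S := by
  induction h with
  | refl => exact h₀
  | tail _ h _ => exact h.2.1

theorem exists_CLSRound {M' : Finset E} (hM : M' ⊆ M) :
    ∃ S, CLSRound (OnePerRobot robot M) g α N M' S := by
  obtain ⟨S₀, h₀⟩ := exists_init g M'
  obtain ⟨S, hS, hmax⟩ := exists_reachable_maximal g fun S hS =>
    (reachable_onePerRobot_of_CLSStep (h₀.onePerRobot hM) hS).1
  exact ⟨S, S₀, h₀, hS, hmax⟩

theorem CLSRound.onePerRobot {M' : Finset E} (hM : M' ⊆ M)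
    (h : CLSRound (OnePerRobot robot M) g α N M' S) : OnePerRobot robot M S := by
  obtain ⟨S₀, h₀, hS, -⟩ := h
  exact reachable_onePerRobot_of_CLSStep (h₀.onePerRobot hM) hS

theorem CLSRound.isLocalOpt (hα : 0 ≤ α) (hgS : 0 ≤ g S)
    (h : CLSRound (OnePerRobot robot M) g α N M S) :
    IsLocalOpt robot g (α / (N : ℝ) ^ 4) M S := by
  intro d a hd ha hadm
  obtain ⟨S₀, h₀, hS, hmax⟩ := h
  have hle : g S ≤ (1 + α / (N : ℝ) ^ 4) * g S :=
    le_mul_of_one_le_left hgS (le_add_of_nonneg_right (by positivity))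
  by_contra! hlt
  -- a set that gains more than the factor would be the result of a step
  refine (hle.trans_lt hlt).not_ge (?_ : g (S \ d.toFinset ∪ a.toFinset) ≤ g S)
  have key : ∀ S' : Finset E, S' = S \ d.toFinset ∪ a.toFinset →
      ((∃ d ∈ S, S' = S \ {d}) ∨ (∃ a ∈ M \ S, S' = S ∪ {a}) ∨
        (∃ d ∈ S, ∃ a ∈ M \ S, S' = (S \ {d}) ∪ {a})) → g S' ≤ g S :=
    fun S' hS' h => hmax S' ⟨h, hS' ▸ hadm, hS' ▸ hlt.le⟩
  rcases d with _ | d <;> rcases a with _ | a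
  · simp
  · by_cases haS : a ∈ S
    · simp [Finset.union_eq_left.mpr (Finset.singleton_subset_iff.mpr haS)]
    · refine key _ rfl (Or.inr (Or.inl ⟨a, ?_, by simp⟩))
      simpa [haS] using ha
  · exact key _ rfl (Or.inl ⟨d, by simpa using hd, by simp⟩)
  · have hdS : d ∈ S := by simpa using hd
    by_cases haS : a ∈ S
    · by_cases had : a = d
      · subst had
        simp [Finset.union_eq_left.mpr (Finset.singleton_subset_iff.mpr haS)]
      · refine key _ rfl (Or.inl ⟨d, hdS, ?_⟩)
        simp only [Option.toFinset_some]
        exact Finset.union_eq_left.mpr (by simp [haS, had])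
    · refine key _ rfl (Or.inr (Or.inr ⟨d, hdS, a, ?_, by simp⟩))
      simpa [haS] using ha

variable {L : Fin n → List E}

theorem DLSStep.onePerRobot {S' : Finset E} (hL : ∀ i, ∀ a ∈ L i, a ∈ M ∧ robot a = i)
    (hS : OnePerRobot robot M S) (h : DLSStep robot g α N L S S') :
    OnePerRobot robot M S' := by
  obtain ⟨i, d, a, ⟨-, ⟨-, rfl⟩ | ⟨hfree, a, ha, -, rfl⟩⟩, -, rfl⟩ := h
  · rw [onePerRobot_iff] at *
    simp only [Option.toFinset_none, Finset.union_empty]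
    exact ⟨Finset.sdiff_subset.trans hS.1, fun a ha b hb =>
      hS.2 a (Finset.sdiff_subset ha) b (Finset.sdiff_subset hb)⟩
  · obtain ⟨haM, hai⟩ := hL i a (List.takeWhile_subset _ ha)
    rw [onePerRobot_iff] at *
    simp only [Option.toFinset_some]
    refine ⟨Finset.union_subset (Finset.sdiff_subset.trans hS.1) (by simpa using haM), ?_⟩
    intro b hb b' hb' hbb
    rw [Finset.mem_union, Finset.mem_singleton] at hb hb'
    rcases hb with hb | rfl <;> rcases hb' with hb' | rfl
    · exact hS.2 b (Finset.sdiff_subset hb) b' (Finset.sdiff_subset hb') hbb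
    · exact absurd (hbb.trans hai) (hfree b hb)
    · exact absurd (hbb.symm.trans hai) (hfree b' hb')
    · rfl

theorem reachable_onePerRobot_of_DLSStep {S₀ : Finset E}
    (hL : ∀ i, ∀ a ∈ L i, a ∈ M ∧ robot a = i) (h₀ : OnePerRobot robot M S₀)
    (h : Relation.ReflTransGen (DLSStep robot g α N L) S₀ S) : OnePerRobot robot M S := by
  induction h with
  | refl => exact h₀
  | tail _ h ih => exact h.onePerRobot hL ih

theorem biUnion_toFinset_subset (hL : ∀ i, ∀ a ∈ L i, a ∈ M ∧ robot a = i) :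
    (Finset.univ.biUnion fun i => (L i).toFinset) ⊆ M := by
  intro a ha
  obtain ⟨i, -, hi⟩ := Finset.mem_biUnion.mp ha
  exact (hL i a (List.mem_toFinset.mp hi)).1

theorem exists_DLSRound (hL : ∀ i, ∀ a ∈ L i, a ∈ M ∧ robot a = i) :
    ∃ S, DLSRound robot g α L S := by
  obtain ⟨S₀, h₀⟩ := exists_init g (Finset.univ.biUnion fun i => (L i).toFinset)
  obtain ⟨S, hS, hmax⟩ := exists_reachable_maximal g fun S hS =>
    (reachable_onePerRobot_of_DLSStep hL (h₀.onePerRobot (biUnion_toFinset_subset hL)) hS).1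
  exact ⟨S, S₀, h₀, hS, hmax⟩

theorem DLSRound.onePerRobot (hL : ∀ i, ∀ a ∈ L i, a ∈ M ∧ robot a = i)
    (h : DLSRound robot g α L S) : OnePerRobot robot M S := by
  obtain ⟨S₀, h₀, hS, -⟩ := h
  exact reachable_onePerRobot_of_DLSStep hL (h₀.onePerRobot (biUnion_toFinset_subset hL)) hS

theorem mem_takeWhile_of_pairwise {β : Type*} {l : List β} {u : β → ℝ} {x : ℝ} {a : β}
    (hl : l.Pairwise fun a b => u b ≤ u a) (ha : a ∈ l) (hx : x ≤ u a) :
    a ∈ l.takeWhile fun b => decide (x ≤ u b) := by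
  induction l with
  | nil => simp at ha
  | cons b l ih =>
    rw [List.pairwise_cons] at hl
    have hb : x ≤ u b := by
      rcases List.mem_cons.mp ha with rfl | ha
      · exact hx
      · exact hx.trans (hl.1 a ha)
    rw [List.takeWhile_cons_of_pos (by simpa using hb)]
    rcases List.mem_cons.mp ha with rfl | ha
    · exact List.mem_cons_self
    · exact List.mem_cons_of_mem _ (ih hl.2 ha)

/-- By submodularity `g(a|S \ {d}) ≤ g(a|∅)`, so breaking off the search through the sorted lists
misses no trajectory that passes the test. -/
theorem DLSRound.isLocalOpt (hα : 0 ≤ α) (hgS : 0 ≤ g S)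
    (hdim : ∀ Q : Finset E, ∀ a ∉ Q, marginal g a Q ≤ marginal g a ∅)
    (hL : SortedLists robot g M L) (h : DLSRound robot g α L S) :
    IsLocalOpt robot g (α / ((∑ i, (L i).length : ℕ) : ℝ) ^ 4) M S := by
  intro d a hd ha hadm
  obtain ⟨S₀, h₀, hS, hmax⟩ := h
  set N := ∑ i, (L i).length
  have hle : g S ≤ (1 + α / (N : ℝ) ^ 4) * g S :=
    le_mul_of_one_le_left hgS (le_add_of_nonneg_right (by positivity))
  by_contra! hlt
  -- as in the centralized case, every exchange passing the test has to be a step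
  refine (hle.trans_lt hlt).not_ge (?_ : g (S \ d.toFinset ∪ a.toFinset) ≤ g S)
  have hdel : ∀ d : Option E, d.toFinset ⊆ S →
      (1 + α / (N : ℝ) ^ 4) * g S < g (S \ d.toFinset) → g (S \ d.toFinset) ≤ g S := by
    intro d hd hlt
    rcases d with _ | d
    · simp
    · refine hmax _ ⟨robot d, some d, none, ⟨hd, Or.inl ⟨?_, rfl⟩⟩, by simp, by simp⟩
      rw [deficiency]
      linarith
  rcases a with _ | a
  · simp only [Option.toFinset_none, Finset.union_empty] at hlt ⊢
    exact hdel d hd hlt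
  simp only [Option.toFinset_some] at hlt hadm ha ⊢
  by_cases haS : a ∈ S \ d.toFinset
  · rw [Finset.union_eq_left.mpr (Finset.singleton_subset_iff.mpr haS)] at hlt ⊢
    exact hdel d hd hlt
  have hdef : deficiency g α N S d ≤ marginal g a (S \ d.toFinset) := by
    rw [deficiency, marginal]
    linarith
  obtain ⟨-, hLmem, hsort⟩ := hL (robot a)
  refine hmax _ ⟨robot a, d, some a, ⟨hd, Or.inr ⟨?_, a, ?_, hdef, rfl⟩⟩, by simp, rfl⟩
  · intro b hb hba
    have hab := (onePerRobot_iff.mp hadm).2 b (Finset.mem_union_left _ hb) a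
      (Finset.mem_union_right _ (Finset.mem_singleton_self a)) hba
    exact haS (hab ▸ hb)
  · exact mem_takeWhile_of_pairwise hsort ((hLmem a).mpr ⟨by simpa using ha, rfl⟩)
      (hdef.trans (hdim _ a haS))

theorem exists_sortedLists (robot : E → Fin n) (g : Finset E → ℝ) (M : Finset E) :
    ∃ L, SortedLists robot g M L := by
  let le : E → E → Bool := fun a b => decide (marginal g b ∅ ≤ marginal g a ∅)
  refine ⟨fun i => (M.filter (robot · = i)).toList.mergeSort le, fun i => ⟨?_, ?_, ?_⟩⟩
  · exact (List.mergeSort_perm _ le).nodup_iff.mpr (Finset.nodup_toList _)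
  · intro a
    rw [(List.mergeSort_perm _ le).mem_iff]
    simp
  · have h := List.pairwise_mergeSort (le := le)
      (fun a b c hab hbc => by
        simp only [le, decide_eq_true_eq] at *
        exact hbc.trans hab)
      (fun a b => by
        simp only [le, Bool.or_eq_true, decide_eq_true_eq]
        exact le_total _ _) (M.filter (robot · = i)).toList
    exact h.imp fun hab => by simpa [le] using hab

/-! ### Local search with two rounds -/

omit [DecidableEq E] in
theorem exists_better (g : Finset E → ℝ) (S₁ S₂ : Finset E) : ∃ S, Better g S₁ S₂ S := by
  rcases le_total (g S₁) (g S₂) with h | h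
  · exact ⟨S₂, Or.inr rfl, h, le_rfl⟩
  · exact ⟨S₁, Or.inl rfl, le_rfl, h⟩

theorem exists_CLSReturns (robot : E → Fin n) (g : Finset E → ℝ) (α : ℝ) (M : Finset E) :
    ∃ S, CLSReturns (OnePerRobot robot M) g α M S := by
  obtain ⟨S₁, h₁⟩ := exists_CLSRound (robot := robot) (g := g) (α := α) (N := M.card)
    (Finset.Subset.refl M)
  obtain ⟨S₂, h₂⟩ := exists_CLSRound (robot := robot) (g := g) (α := α) (N := M.card)
    (Finset.sdiff_subset : M \ S₁ ⊆ M)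
  obtain ⟨S, h⟩ := exists_better g S₁ S₂
  exact ⟨S, S₁, S₂, h₁, h₂, h⟩

theorem SortedLists.mem (hL : SortedLists robot g M L) (i : Fin n) :
    ∀ a ∈ L i, a ∈ M ∧ robot a = i :=
  fun a => ((hL i).2.1 a).mp

theorem SortedLists.mem_filter (hL : SortedLists robot g M L) (Q : Finset E) (i : Fin n) :
    ∀ a ∈ (L i).filter (fun a => decide (a ∉ Q)), a ∈ M ∧ robot a = i :=
  fun a ha => hL.mem i a (List.mem_of_mem_filter ha)

theorem SortedLists.card_le (hL : SortedLists robot g M L) : M.card ≤ ∑ i, (L i).length := by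
  have hsub : M ⊆ Finset.univ.biUnion fun i => (L i).toFinset := fun a ha =>
    Finset.mem_biUnion.mpr ⟨robot a, Finset.mem_univ _,
      List.mem_toFinset.mpr (((hL (robot a)).2.1 a).mpr ⟨ha, rfl⟩)⟩
  exact (Finset.card_le_card hsub).trans
    (Finset.card_biUnion_le.trans (Finset.sum_le_sum fun i _ => List.toFinset_card_le _))

theorem exists_DLSReturns (robot : E → Fin n) (g : Finset E → ℝ) (α : ℝ) (M : Finset E) :
    ∃ S, DLSReturns robot g α M S := by
  obtain ⟨L, hL⟩ := exists_sortedLists robot g M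
  obtain ⟨S₁, h₁⟩ := exists_DLSRound (g := g) (α := α) hL.mem
  obtain ⟨S₂, h₂⟩ := exists_DLSRound (g := g) (α := α) (hL.mem_filter S₁)
  obtain ⟨S, h⟩ := exists_better g S₁ S₂
  exact ⟨S, L, hL, S₁, S₂, h₁, h₂, h⟩

section Guarantee

variable {f : Finset E → ℝ} {c : E → ℝ} {R : ℝ}

theorem marginal_le_marginal_empty (hg : ∀ S, g S = f S - ∑ a ∈ S, c a + R)
    (hsub : ∀ A B, f (A ∪ B) + f (A ∩ B) ≤ f A + f B) (Q : Finset E) {a : E} (ha : a ∉ Q) :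
    marginal g a Q ≤ marginal g a ∅ := by
  have h := hsub Q {a}
  have hd : Disjoint Q {a} := Finset.disjoint_singleton_right.mpr ha
  rw [Finset.disjoint_iff_inter_eq_empty.mp hd] at h
  simp only [marginal, hg, Finset.empty_union, Finset.sum_union hd, Finset.sum_empty]
  linarith

/-- The sets returned by either algorithm are admissible, and the first round alone attains the
factor `2 + α`. -/
theorem onePerRobot_and_le_of_returns (hα : 0 ≤ α) (hg : ∀ S, g S = f S - ∑ a ∈ S, c a + R)
    (hmono : Monotone f) (hsub : ∀ A B, f (A ∪ B) + f (A ∩ B) ≤ f A + f B) (hf : 0 ≤ f ∅)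
    (hR : ∀ S, OnePerRobot robot M S → ∑ a ∈ S, c a ≤ R)
    (hgnn : ∀ S, OnePerRobot robot M S → 0 ≤ g S)
    (h : CLSReturns (OnePerRobot robot M) g α M S ∨ DLSReturns robot g α M S)
    (hC : OnePerRobot robot M C) :
    OnePerRobot robot M S ∧ g C ≤ (2 + α) * g S := by
  obtain ⟨S₁, S₂, hS₁, hS₂, hbetter, hle⟩ : ∃ S₁ S₂, OnePerRobot robot M S₁ ∧
      OnePerRobot robot M S₂ ∧ Better g S₁ S₂ S ∧ g C ≤ (2 + α) * g S₁ := by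
    rcases h with ⟨S₁, S₂, h₁, h₂, hb⟩ | ⟨L, hL, S₁, S₂, h₁, h₂, hb⟩
    · have hS₁ := h₁.onePerRobot (Finset.Subset.refl M)
      exact ⟨S₁, S₂, hS₁, h₂.onePerRobot Finset.sdiff_subset, hb,
        (h₁.isLocalOpt hα (hgnn _ hS₁)).le_mul hα le_rfl hg hmono hsub hf hR hS₁ hC⟩
    · have hS₁ := h₁.onePerRobot hL.mem
      exact ⟨S₁, S₂, hS₁, h₂.onePerRobot (hL.mem_filter S₁), hb,
        (h₁.isLocalOpt hα (hgnn _ hS₁) (fun Q _ => marginal_le_marginal_empty hg hsub Q)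
          hL).le_mul hα hL.card_le hg hmono hsub hf hR hS₁ hC⟩
  refine ⟨?_, hle.trans (mul_le_mul_of_nonneg_left hbetter.2.1 (by linarith))⟩
  rcases hbetter.1 with rfl | rfl
  exacts [hS₁, hS₂]

end Guarantee

end LocalSearch

/-! ### The objective on admissible sets -/

namespace AcquisitionProblem

variable {n T dy : ℕ} {X U : Fin n → Type*} (P : AcquisitionProblem n T dy X U)

/-- An admissible set contains at most one trajectory of each robot `i`, whose weighted cost is
at most `r i * cmax`. -/
theorem energy_le_of_admissible {S : Finset (Trajectory T U)} (hS : P.Admissible S) :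
    P.energy S ≤ ∑ i, P.r i * P.cmax := by
  have hmem : ∀ σ ∈ S, σ.2 ∈ P.M σ.1 := fun σ hσ => (Finset.mem_sigma.mp (hS.1 hσ)).2
  rw [energy, ← Finset.sum_fiberwise S fun σ => σ.1]
  refine Finset.sum_le_sum fun i _ => ?_
  have hnn : 0 ≤ P.r i * P.cmax := mul_nonneg (P.r_nonneg i) P.cmax_nonneg
  have hle : ∀ σ ∈ S.filter (fun σ => σ.1 = i),
      P.r σ.1 * P.cost σ.1 σ.2 ≤ P.r i * P.cmax := by
    intro σ hσ
    obtain ⟨hσS, rfl⟩ := Finset.mem_filter.mp hσ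
    exact mul_le_mul_of_nonneg_left (P.cost_le _ _ (hmem σ hσS)) (P.r_nonneg _)
  refine (Finset.sum_le_card_nsmul _ _ _ hle).trans ?_
  rw [nsmul_eq_mul]
  exact mul_le_of_le_one_left hnn (by exact_mod_cast hS.2 i)

theorem g_nonneg_of_admissible {P : AcquisitionProblem n T dy X U} (hP : P.Nondegenerate)
    {S : Finset (Trajectory T U)} (hS : P.Admissible S) : 0 ≤ P.g S := by
  have h := mutualInfo_mono hP (Finset.empty_subset S)
  rw [mutualInfo_empty hP] at h
  rw [g, J]
  linarith [P.energy_le_of_admissible hS]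

end AcquisitionProblem

theorem proposition1 {n T dy : ℕ} {X U : Fin n → Type*} [∀ i, DecidableEq (U i)]
    (P : AcquisitionProblem n T dy X U) (hP : P.Nondegenerate) (α : ℝ) (hα : 0 < α) :
    (∀ S, P.Admissible S → 0 ≤ P.g S) ∧
    (∃ Sls, LocalSearch.CLSReturns P.Admissible P.g α P.ground Sls) ∧
    (∃ Sls, LocalSearch.DLSReturns (fun σ : Trajectory T U => σ.1) P.g α P.ground Sls) ∧
    ∀ Sopt, P.Admissible Sopt → (∀ S, P.Admissible S → P.g S ≤ P.g Sopt) →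
      ∀ Sls, (LocalSearch.CLSReturns P.Admissible P.g α P.ground Sls ∨
          LocalSearch.DLSReturns (fun σ : Trajectory T U => σ.1) P.g α P.ground Sls) →
        P.Admissible Sls ∧ 0 ≤ P.g Sopt ∧ P.g Sopt ≤ 4 * (1 + α) * P.g Sls := by
  refine ⟨fun S => P.g_nonneg_of_admissible hP, LocalSearch.exists_CLSReturns _ _ _ _,
    LocalSearch.exists_DLSReturns _ _ _ _, fun Sopt hopt _ Sls hret => ?_⟩
  obtain ⟨hadm, hle⟩ := LocalSearch.onePerRobot_and_le_of_returns hα.le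
    (fun _ => rfl) (P.mutualInfo_mono hP) (P.mutualInfo_submodular hP) (P.mutualInfo_empty hP).ge
    (fun S => P.energy_le_of_admissible) (fun S => P.g_nonneg_of_admissible hP) hret hopt
  refine ⟨hadm, P.g_nonneg_of_admissible hP hopt, hle.trans ?_⟩
  exact mul_le_mul_of_nonneg_right (by linarith) (P.g_nonneg_of_admissible hP hadm)
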